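/- Let $V$ be a finite-dimensional Euclidean space, $k_V:V^*\to(0,\infty)$ an integrable function with $\int_{V^*}k_V\,d\omega=1$, and let $\mathcal H$ be the space of functions $f:V\to\mathbb C$, $f(x)=\int_{V^*}\hat f(\omega)e^{2\pi i\langle x,\omega\rangle}d\omega$ with $\|f\|_{\mathcal H}^2=\int_{V^*}|\hat f|^2/k_V\,d\omega<\infty$. Let $X$ be a random variable valued in $V$, $Y$ a complex random variable with $\mathbb E|Y|^2<\infty$, and $\lambda>0$. For $U\in\mathrm{End}(V)$ put $$J(U,\lambda)=\inf_{f\in\mathcal H}\ \tfrac12\mathbb E|Y-f(UX)|^2+\tfrac{\lambda}{2}\|f\|_{\mathcal H}^2 .$$ Fix an orthogonal decomposition $V=W\oplus W'$, write $X=(X_W,X_{W'})$, and let $\mathcal H_W$ be the space of functions on $W$ defined in the same way from $k_W(\omega_W)=\int_{W'^*}k_V(\omega_W,\omega_{W'})\,d\omega_{W'}$. Let $\{a_i\}$ be the (at most countable, possibly empty) set of atoms of the law of $X_{W'}$, and for $T\in\mathrm{End}(W)$ put $$J_i(T,\lambda)=\inf_{g\in\mathcal H_W}\ \tfrac12\mathbb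 E\big[|Y-g(TX_W)|^2\mathbf 1_{X_{W'}=a_i}\big]+\tfrac{\lambda}{2}\|g\|_{\mathcal H_W}^2 .$$ Let $U=U^{(k)}=\begin{pmatrix}U_{11}&U_{12}\\U_{21}&U_{22}\end{pmatrix}$, $k\in\mathbb N$, be a sequence in $\mathrm{End}(W\oplus W')$ such that $U_{11}\to U_{11}^\infty\in\mathrm{End}(W)$ as $k\to\infty$, $U_{21}=0$, $U_{12}$ is arbitrary, and $|U_{22}x|\ge\Lambda_k|x|$ for all $x\in W'$, where $\Lambda_k\to+\infty$. Then the series $\sum_iJ_i(U_{11}^\infty,\lambda)$ converges and $$\lim_{k\to\infty}J(U^{(k)},\lambda)=\tfrac12\mathbb E\big[|Y|^2\mathbf 1_{X_{W'}\notin\{a_i\}}\big]+\sum_iJ_i(U_{11}^\infty,\lambda).$$ -/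

import Mathlib

open MeasureTheory Filter Topology
open scoped ENNReal FourierTransform

namespace KernelRidge

noncomputable section

/-! The dual of a Euclidean space `E` is identified with `E` through the inner product, and `volume`
on a Euclidean space is Lebesgue measure.  The Fourier pair is
`f x = ∫ exp (2πi⟪x, ω⟫) φ ω dω`, which is Mathlib's `f = 𝓕⁻ φ`. -/

section RKHS

variable {E : Type*} [NormedAddCommGroup E] [InnerProductSpace ℝ E] [FiniteDimensional ℝ E]
  [MeasurableSpace E] [BorelSpace E]

/-- `φ` is the (integrable) Fourier transform of `f`. Such a `φ` is unique up to null sets. -/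
def IsFourierTransformOf (φ f : E → ℂ) : Prop :=
  Integrable φ ∧ ∀ x, f x = 𝓕⁻ φ x

/-- The squared norm `∫ |f̂ ω|² / k ω dω`, and `∞` if `f` has no integrable Fourier transform `f̂`.
(As `f̂` is unique up to null sets, the infimum is over at most one value. If `∫ k = 1`, then every
measurable `f̂` with `∫ |f̂|² / k < ∞` is integrable.) -/
def normSq (k : E → ℝ≥0∞) (f : E → ℂ) : ℝ≥0∞ :=
  ⨅ (φ : E → ℂ) (_ : IsFourierTransformOf φ f), ∫⁻ ω, ‖φ ω‖ₑ ^ 2 / k ω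

/-- The translation invariant reproducing kernel Hilbert space with spectral density `k`. -/
def space (k : E → ℝ≥0∞) : Set (E → ℂ) :=
  {f | normSq k f < ∞}

variable {Ω : Type*} [MeasurableSpace Ω]

/-- The ridge loss `½ ∫ |Y - f(Z)|² dμ + (lam / 2) ‖f‖²` of a function `f`. -/
def loss (k : E → ℝ≥0∞) (μ : Measure Ω) (Z : Ω → E) (Y : Ω → ℂ) (lam : ℝ) (f : E → ℂ) : ℝ :=
  1 / 2 * ∫ ω, ‖Y ω - f (Z ω)‖ ^ 2 ∂μ + lam / 2 * (normSq k f).toReal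

/-- The infimum of the ridge loss over the reproducing kernel Hilbert space. -/
def value (k : E → ℝ≥0∞) (μ : Measure Ω) (Z : Ω → E) (Y : Ω → ℂ) (lam : ℝ) : ℝ :=
  ⨅ f : space k, loss k μ Z Y lam f

end RKHS

variable {V : Type*} [NormedAddCommGroup V] [InnerProductSpace ℝ V] [FiniteDimensional ℝ V]

/-- The matrix entry of `U` that maps the subspace `A` to the subspace `B`, where the projection to
`B` is orthogonal. -/
def block (A B : Submodule ℝ V) (U : V →L[ℝ] V) : A →L[ℝ] B :=
  B.orthogonalProjectionOnto ∘L U ∘L A.subtypeL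

variable [MeasurableSpace V] [BorelSpace V]

/-- The density `k_V` on (the dual of) `V`, with values in `[0, ∞]`. -/
def density (kV : V → ℝ) (ω : V) : ℝ≥0∞ :=
  ENNReal.ofReal (kV ω)

/-- The reduced density `k_W(ω_W) = ∫ k_V(ω_W, ω_{W'}) dω_{W'}`, where `W' = Wᗮ`. -/
def reducedDensity (kV : V → ℝ) (W : Submodule ℝ V) (η : W) : ℝ≥0∞ :=
  ∫⁻ ξ : Wᗮ, density kV ((η : V) + (ξ : V))

variable {Ω : Type*} [MeasurableSpace Ω]

/-- `J(U, lam) = inf_f ½ E|Y - f(UX)|² + (lam / 2) ‖f‖²`. -/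
def J (kV : V → ℝ) (P : Measure Ω) (X : Ω → V) (Y : Ω → ℂ) (U : V →L[ℝ] V) (lam : ℝ) : ℝ :=
  value (density kV) P (fun ω => U (X ω)) Y lam

/-- The component `X_{W'}` of `X` in `W' = Wᗮ`. -/
def perpPart (W : Submodule ℝ V) (X : Ω → V) (ω : Ω) : Wᗮ :=
  Wᗮ.orthogonalProjectionOnto (X ω)

/-- The atoms of the marginal law of `X_{W'}`. -/
def atoms (P : Measure Ω) (W : Submodule ℝ V) (X : Ω → V) : Set Wᗮ :=
  {a | P.map (perpPart W X) {a} ≠ 0}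

/-- The reduced problem on the slice `x_{W'} = a`:
`inf_g ½ E[|Y - g(T X_W)|² 1_{X_{W'} = a}] + (lam / 2) ‖g‖²` over `g` in the reproducing kernel
Hilbert space on `W` with spectral density `k_W`. -/
def reducedJ (kV : V → ℝ) (P : Measure Ω) (W : Submodule ℝ V) (X : Ω → V) (Y : Ω → ℂ) (a : Wᗮ)
    (T : W →L[ℝ] W) (lam : ℝ) : ℝ :=
  value (reducedDensity kV W) (P.restrict {ω | perpPart W X ω = a})
    (fun ω => T (W.orthogonalProjectionOnto (X ω))) Y lam

end

end KernelRidge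

/-!
The proof is by convex duality. For a spectral density `k` and a map `Z : Ω → E` let
`K(x) = ∫ e^{2πi⟨x, ξ⟩} k(ξ) dξ` be the reproducing kernel and let `G` be the integral operator on
`L²(μ)` with kernel `K(Z x - Z x')`. Every `α ∈ L²(μ)` bounds the infimum of the ridge loss on both
sides. From below it is at least the dual objective `Re ⟨α, Y⟩ - ½‖α‖² - ⟨α, Gα⟩ / (2 lam)`
(`le_value`), by a Fenchel–Young inequality on the frequency side; from above it is at most the loss
`½‖Y - Gα / lam‖² + ⟨α, Gα⟩ / (2 lam)` of the function `Gα / lam` (`value_le`). If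
`(lam + G) α = lam Y`, then the two bounds agree and equal `½ Re ⟨α, Y⟩` (`value_eq`).

Both bounds depend on the problem only through its kernel and are, for fixed `α`, continuous under
bounded pointwise convergence of kernels. Hence, if the kernels of a sequence of problems converge
pointwise to some `κ` with operator `G`, the values converge to `½ Re ⟨α, Y⟩`, where `α` solves
`(lam + G) α = lam Y` for the limit kernel (`exists_tendsto_value`); the solution exists because `G`
inherits positivity, so that `lam + G` is coercive.

For the sequence `U n`, the limit kernel vanishes unless `X_{W'} = X'_{W'}`, by the Riemann–Lebesgue
lemma and `|U₂₂ x| ≥ Λ |x|`. On that diagonal it is the kernel of the reduced problem, since the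
restriction of the kernel of `k_V` to `W` is the kernel of `k_W`
(`tendsto_pullbackKernel_sliceKernel`). The limit equation therefore decouples over the values of
`X_{W'}`: on the slice over an atom `α` solves the equation of the reduced problem, so the slice
contributes the reduced value, and off the atoms the operator is zero, so `α = Y` and the
contribution is `½ ∫ |Y|²`.
-/

namespace KernelRidge

open ComplexConjugate
open scoped RealInnerProductSpace

/-! ### Integral operators with bounded kernels -/

section IntegralOperator

variable {Ω : Type*} [MeasurableSpace Ω] {μ : Measure Ω} {κ : Ω → Ω → ℂ} {C : ℝ} {α y : Ω → ℂ}

/-- The integral operator `(Gα)(x) = ∫ κ(x, x') α(x') dμ(x')` with kernel `κ`, as a map on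
functions. -/
noncomputable def integralOp (κ : Ω → Ω → ℂ) (μ : Measure Ω) (α : Ω → ℂ) (x : Ω) : ℂ :=
  ∫ x', κ x x' * α x' ∂μ

/-- The quadratic form `Re ⟨α, Gα⟩` of the integral operator `G` with kernel `κ`. -/
noncomputable def energy (κ : Ω → Ω → ℂ) (μ : Measure Ω) (α : Ω → ℂ) : ℝ :=
  (∫ x, conj (α x) * integralOp κ μ α x ∂μ).re

lemma integrable_conj (hα : Integrable α μ) : Integrable (fun x => conj (α x)) μ :=
  hα.congr' (hα.1.star) (Eventually.of_forall fun x => by simp)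

lemma memLp_conj (hα : MemLp α 2 μ) : MemLp (fun x => conj (α x)) 2 μ :=
  hα.congr_norm hα.1.star (Eventually.of_forall fun x => by simp)

lemma integrable_kernel_mul (hκ : StronglyMeasurable (Function.uncurry κ))
    (hC : ∀ x x', ‖κ x x'‖ ≤ C) (hα : Integrable α μ) (x : Ω) :
    Integrable (fun x' => κ x x' * α x') μ :=
  hα.bdd_mul (hκ.comp_measurable measurable_prodMk_left).aestronglyMeasurable
    (Eventually.of_forall (hC x))

lemma norm_integralOp_le (hC : ∀ x x', ‖κ x x'‖ ≤ C) (hα : Integrable α μ) (x : Ω) :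
    ‖integralOp κ μ α x‖ ≤ C * ∫ x', ‖α x'‖ ∂μ := by
  rw [← integral_const_mul]
  refine norm_integral_le_of_norm_le (hα.norm.const_mul C) (Eventually.of_forall fun x' => ?_)
  rw [norm_mul]
  exact mul_le_mul_of_nonneg_right (hC x x') (norm_nonneg _)

lemma integralOp_congr {β : Ω → ℂ} (h : α =ᵐ[μ] β) : integralOp κ μ α = integralOp κ μ β := by
  funext x
  refine integral_congr_ae ?_
  filter_upwards [h] with x' hx'
  rw [hx']

variable {κs : ℕ → Ω → Ω → ℂ}

lemma tendsto_integralOp (hκ : ∀ n, StronglyMeasurable (Function.uncurry (κs n)))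
    (hC : ∀ n x x', ‖κs n x x'‖ ≤ C)
    (hlim : ∀ x x', Tendsto (fun n => κs n x x') atTop (𝓝 (κ x x'))) (hα : Integrable α μ)
    (x : Ω) : Tendsto (fun n => integralOp (κs n) μ α x) atTop (𝓝 (integralOp κ μ α x)) := by
  refine tendsto_integral_of_dominated_convergence (fun x' => C * ‖α x'‖)
    (fun n => (integrable_kernel_mul (hκ n) (hC n) hα x).1) (hα.norm.const_mul C)
    (fun n => Eventually.of_forall fun x' => ?_)
    (Eventually.of_forall fun x' => (hlim x x').mul_const _)
  rw [norm_mul]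
  exact mul_le_mul_of_nonneg_right (hC n x x') (norm_nonneg _)

variable [IsFiniteMeasure μ]

lemma aestronglyMeasurable_integralOp (hκ : StronglyMeasurable (Function.uncurry κ))
    (hα : AEStronglyMeasurable α μ) : AEStronglyMeasurable (integralOp κ μ α) μ :=
  (hκ.aestronglyMeasurable.mul hα.comp_snd).integral_prod_right'

lemma memLp_integralOp (hκ : StronglyMeasurable (Function.uncurry κ))
    (hC : ∀ x x', ‖κ x x'‖ ≤ C) (hα : Integrable α μ) : MemLp (integralOp κ μ α) 2 μ :=
  MemLp.of_bound (aestronglyMeasurable_integralOp hκ hα.1) _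
    (Eventually.of_forall (norm_integralOp_le hC hα))

/-- The integral operator of a bounded kernel, as a bounded operator on `L²(μ)`. -/
lemma exists_integralOp_clm (hκ : StronglyMeasurable (Function.uncurry κ))
    (hC : ∀ x x', ‖κ x x'‖ ≤ C) :
    ∃ G : Lp ℂ 2 μ →L[ℂ] Lp ℂ 2 μ, ∀ f : Lp ℂ 2 μ, G f =ᵐ[μ] integralOp κ μ f := by
  have hint (f : Lp ℂ 2 μ) : Integrable f μ := (Lp.memLp f).integrable (by norm_num)
  let G₀ : Lp ℂ 2 μ →ₗ[ℂ] Lp ℂ 2 μ :=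
    { toFun := fun f => (memLp_integralOp hκ hC (hint f)).toLp _
      map_add' := fun f g => by
        rw [← MemLp.toLp_add]
        refine MemLp.toLp_congr _ _ (Eventually.of_forall fun x => ?_)
        rw [integralOp_congr (Lp.coeFn_add f g)]
        simp only [integralOp, Pi.add_apply, mul_add]
        exact integral_add (integrable_kernel_mul hκ hC (hint f) x)
          (integrable_kernel_mul hκ hC (hint g) x)
      map_smul' := fun c f => by
        rw [RingHom.id_apply, ← MemLp.toLp_const_smul]
        refine MemLp.toLp_congr _ _ (Eventually.of_forall fun x => ?_)
        rw [integralOp_congr (Lp.coeFn_smul c f)]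
        simp only [integralOp, Pi.smul_apply, smul_eq_mul, mul_left_comm _ c]
        exact integral_const_mul _ _ }
  obtain hΩ | ⟨⟨x₀⟩⟩ := isEmpty_or_nonempty Ω
  · exact ⟨0, fun f => Eventually.of_forall fun x => hΩ.elim x⟩
  have hC0 : 0 ≤ C := (norm_nonneg _).trans (hC x₀ x₀)
  -- Both `L¹ ≤ L²` and `L² ≤ L^∞` on the finite measure cost a factor `μ(Ω)^(1/2)`.
  have hbound (f : Lp ℂ 2 μ) :
      ‖G₀ f‖ ≤ (μ.real Set.univ ^ (2⁻¹ : ℝ) * (C * μ.real Set.univ ^ (2⁻¹ : ℝ))) * ‖f‖ := by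
    have h1 : ∫ x, ‖f x‖ ∂μ ≤ μ.real Set.univ ^ (2⁻¹ : ℝ) * ‖f‖ := by
      have h := eLpNorm_le_eLpNorm_mul_rpow_measure_univ (p := 1) (q := 2) (μ := μ) (f := f)
        (by norm_num) (Lp.aestronglyMeasurable f)
      rw [eLpNorm_one_eq_lintegral_enorm] at h
      rw [integral_norm_eq_lintegral_enorm (Lp.aestronglyMeasurable f), Lp.norm_def]
      refine (ENNReal.toReal_mono ?_ h).trans (le_of_eq ?_)
      · exact ENNReal.mul_ne_top (Lp.eLpNorm_ne_top f)
          (ENNReal.rpow_ne_top_of_nonneg (by norm_num) (measure_ne_top _ _))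
      · rw [ENNReal.toReal_mul, ← ENNReal.toReal_rpow, mul_comm, Measure.real]
        norm_num
    have h2 : ‖G₀ f‖ ≤ μ.real Set.univ ^ (2⁻¹ : ℝ) * (C * ∫ x, ‖f x‖ ∂μ) := by
      refine (Lp.norm_le_of_ae_bound (C := C * ∫ x, ‖f x‖ ∂μ) (by positivity) ?_).trans
        (le_of_eq ?_)
      · filter_upwards [(memLp_integralOp hκ hC (hint f)).coeFn_toLp] with x hx
        change ‖((memLp_integralOp hκ hC (hint f)).toLp _ : Lp ℂ 2 μ) x‖ ≤ _
        rw [hx]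
        exact norm_integralOp_le hC (hint f) x
      · simp only [measureUnivNNReal, Measure.real, ENNReal.toReal_ofNat]
        rfl
    calc _ ≤ _ := h2
      _ ≤ μ.real Set.univ ^ (2⁻¹ : ℝ) * (C * (μ.real Set.univ ^ (2⁻¹ : ℝ) * ‖f‖)) := by gcongr
      _ = _ := by ring
  exact ⟨G₀.mkContinuous _ hbound, fun f => (memLp_integralOp hκ hC (hint f)).coeFn_toLp⟩

/-- For a bounded positive kernel the equation `(lam + G) α = lam y` is solvable in `L²`, because
`lam + G` is coercive. -/
lemma exists_add_integralOp_eq (hκ : StronglyMeasurable (Function.uncurry κ))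
    (hC : ∀ x x', ‖κ x x'‖ ≤ C) (hpos : ∀ α : Ω → ℂ, MemLp α 2 μ → 0 ≤ energy κ μ α)
    {lam : ℝ} (hlam : 0 < lam) (hy : MemLp y 2 μ) :
    ∃ α, MemLp α 2 μ ∧ ∀ᵐ x ∂μ, (lam : ℂ) * α x + integralOp κ μ α x = lam * y x := by
  obtain ⟨G, hG⟩ := exists_integralOp_clm (μ := μ) hκ hC
  let T : Lp ℂ 2 μ →L[ℂ] Lp ℂ 2 μ := (lam : ℂ) • ContinuousLinearMap.id ℂ _ + G
  have hT : IsUnit T := by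
    refine ContinuousLinearMap.isUnit_of_forall_le_norm_inner_map T (c := ⟨lam, hlam.le⟩) hlam
      fun f => ?_
    have hGf : 0 ≤ (inner ℂ f (G f)).re := by
      refine (hpos f (Lp.memLp f)).trans_eq ?_
      unfold energy
      rw [L2.inner_def]
      congr 1
      refine integral_congr_ae ?_
      filter_upwards [hG f] with x hx
      rw [hx, RCLike.inner_apply, mul_comm]
    rw [norm_inner_symm]
    refine le_trans ?_ (Complex.re_le_norm _)
    have : inner ℂ f (T f) = (lam : ℂ) * inner ℂ f f + inner ℂ f (G f) := by
      change inner ℂ f ((lam : ℂ) • f + G f) = _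
      rw [inner_add_right, inner_smul_right]
    rw [this, Complex.add_re, Complex.re_ofReal_mul, inner_self_eq_norm_sq_to_K]
    have h2 : (((‖f‖ : ℝ) : ℂ) ^ 2).re = ‖f‖ ^ 2 := by norm_cast
    change ‖f‖ ^ 2 * lam ≤ lam * (((‖f‖ : ℝ) : ℂ) ^ 2).re + _
    rw [h2]
    linarith
  obtain ⟨f, hf⟩ := ((ContinuousLinearMap.isUnit_iff_bijective).1 hT).2 ((lam : ℂ) • hy.toLp y)
  refine ⟨f, Lp.memLp f, ?_⟩
  have h1 : T f = (lam : ℂ) • f + G f := rfl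
  rw [h1] at hf
  have h2 : ((lam : ℂ) • f + G f : Lp ℂ 2 μ) =ᵐ[μ] ((lam : ℂ) • hy.toLp y : Lp ℂ 2 μ) := by rw [hf]
  filter_upwards [h2, hG f, Lp.coeFn_add ((lam : ℂ) • f) (G f), Lp.coeFn_smul (lam : ℂ) f,
    Lp.coeFn_smul (lam : ℂ) (hy.toLp y), hy.coeFn_toLp] with x a1 a2 a3 a4 a5 a6
  rw [a3, a5, Pi.add_apply, a4, Pi.smul_apply, Pi.smul_apply, a2, a6, smul_eq_mul, smul_eq_mul]
    at a1
  exact a1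

lemma tendsto_energy (hκ : ∀ n, StronglyMeasurable (Function.uncurry (κs n)))
    (hC : ∀ n x x', ‖κs n x x'‖ ≤ C)
    (hlim : ∀ x x', Tendsto (fun n => κs n x x') atTop (𝓝 (κ x x'))) (hα : Integrable α μ) :
    Tendsto (fun n => energy (κs n) μ α) atTop (𝓝 (energy κ μ α)) := by
  refine (Complex.continuous_re.tendsto _).comp ?_
  refine tendsto_integral_of_dominated_convergence (fun x => ‖α x‖ * (C * ∫ x', ‖α x'‖ ∂μ))
    (fun n => (integrable_conj hα).1.mul (aestronglyMeasurable_integralOp (hκ n) hα.1))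
    (hα.norm.mul_const _)
    (fun n => Eventually.of_forall fun x => ?_)
    (Eventually.of_forall fun x => (tendsto_integralOp hκ hC hlim hα x).const_mul _)
  rw [norm_mul, Complex.norm_conj]
  exact mul_le_mul_of_nonneg_left (norm_integralOp_le (hC n) hα x) (norm_nonneg _)

lemma tendsto_integral_sq_sub_integralOp
    (hκ : ∀ n, StronglyMeasurable (Function.uncurry (κs n)))
    (hC : ∀ n x x', ‖κs n x x'‖ ≤ C)
    (hlim : ∀ x x', Tendsto (fun n => κs n x x') atTop (𝓝 (κ x x'))) (hα : Integrable α μ)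
    (hy : MemLp y 2 μ) (c : ℂ) :
    Tendsto (fun n => ∫ x, ‖y x - c * integralOp (κs n) μ α x‖ ^ 2 ∂μ) atTop
      (𝓝 (∫ x, ‖y x - c * integralOp κ μ α x‖ ^ 2 ∂μ)) := by
  refine tendsto_integral_of_dominated_convergence
    (fun x => (‖y x‖ + ‖c‖ * (C * ∫ x', ‖α x'‖ ∂μ)) ^ 2)
    (fun n => ((hy.1.sub ((aestronglyMeasurable_integralOp (hκ n) hα.1).const_mul c)).norm.pow 2))
    ((hy.norm.add (memLp_const _)).integrable_sq)
    (fun n => Eventually.of_forall fun x => ?_)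
    (Eventually.of_forall fun x =>
      (((tendsto_integralOp hκ hC hlim hα x).const_mul c).const_sub (y x)).norm.pow 2)
  rw [Real.norm_of_nonneg (by positivity)]
  gcongr
  refine (norm_sub_le _ _).trans ?_
  rw [norm_mul]
  gcongr
  exact norm_integralOp_le (hC n) hα x

end IntegralOperator

/-! ### Kernel ridge regression on the frequency side -/

section Spectral

variable {E : Type*} [NormedAddCommGroup E] [InnerProductSpace ℝ E] [FiniteDimensional ℝ E]
  [MeasurableSpace E] [BorelSpace E] {k : E → ℝ≥0∞}

/-- The reproducing kernel `K(x) = ∫ e^{2πi⟨x, ξ⟩} k(ξ) dξ` with spectral density `k`. -/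
noncomputable def spectralKernel (k : E → ℝ≥0∞) (x : E) : ℂ :=
  𝓕⁻ (fun ξ => ((k ξ).toReal : ℂ)) x

lemma integrable_ofReal_toReal (hk : AEMeasurable k) (hfin : ∫⁻ ξ, k ξ ≠ ∞) :
    Integrable (fun ξ => ((k ξ).toReal : ℂ)) :=
  (integrable_toReal_of_lintegral_ne_top hk hfin).ofReal

lemma continuous_fourierInv {φ : E → ℂ} (hφ : Integrable φ) : Continuous (𝓕⁻ φ) :=
  VectorFourier.fourierIntegral_continuous Real.continuous_fourierChar
    (by simp only [LinearMap.neg_apply, innerₗ_apply_apply]; fun_prop) hφ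

lemma norm_fourierInv_le (φ : E → ℂ) (x : E) : ‖𝓕⁻ φ x‖ ≤ ∫ ξ, ‖φ ξ‖ := by
  rw [Real.fourierInv_eq]
  refine (norm_integral_le_integral_norm _).trans (le_of_eq ?_)
  simp

lemma continuous_spectralKernel (hk : AEMeasurable k) (hfin : ∫⁻ ξ, k ξ ≠ ∞) :
    Continuous (spectralKernel k) :=
  continuous_fourierInv (integrable_ofReal_toReal hk hfin)

lemma norm_spectralKernel_le (k : E → ℝ≥0∞) (x : E) :
    ‖spectralKernel k x‖ ≤ ∫ ξ, (k ξ).toReal := by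
  refine (norm_fourierInv_le _ x).trans (le_of_eq ?_)
  simp

lemma tendsto_spectralKernel_cocompact (k : E → ℝ≥0∞) :
    Tendsto (spectralKernel k) (cocompact E) (𝓝 0) := by
  have h := (tendsto_integral_exp_inner_smul_cocompact (fun ξ : E => ((k ξ).toReal : ℂ))).comp
    (Homeomorph.neg E).isClosedEmbedding.tendsto_cocompact
  refine h.congr fun x => ?_
  simp [spectralKernel, Real.fourierInv_eq]

lemma conj_spectralKernel (k : E → ℝ≥0∞) (x : E) :
    conj (spectralKernel k x) = spectralKernel k (-x) := by
  rw [spectralKernel, spectralKernel, Real.fourierInv_eq, Real.fourierInv_eq, ← integral_conj]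
  refine integral_congr_ae (Eventually.of_forall fun ξ => ?_)
  simp [Circle.smul_def]

variable {Ω : Type*} [MeasurableSpace Ω] {μ : Measure Ω} {Z : Ω → E} {α Y : Ω → ℂ}

/-- The kernel `K(Z x - Z x')` on `Ω` that the spectral density `k` induces through `Z`. -/
noncomputable def pullbackKernel (k : E → ℝ≥0∞) (Z : Ω → E) (x x' : Ω) : ℂ :=
  spectralKernel k (Z x - Z x')

lemma stronglyMeasurable_pullbackKernel (hk : AEMeasurable k) (hfin : ∫⁻ ξ, k ξ ≠ ∞)
    (hZ : Measurable Z) : StronglyMeasurable (Function.uncurry (pullbackKernel k Z)) :=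
  ((continuous_spectralKernel hk hfin).measurable.comp
    ((hZ.comp measurable_fst).sub (hZ.comp measurable_snd))).stronglyMeasurable

omit [MeasurableSpace Ω] in
lemma norm_pullbackKernel_le (k : E → ℝ≥0∞) (Z : Ω → E) (x x' : Ω) :
    ‖pullbackKernel k Z x x'‖ ≤ ∫ ξ, (k ξ).toReal :=
  norm_spectralKernel_le k _

/-- The Fourier transform `ξ ↦ ∫ e^{-2πi⟨Z x, ξ⟩} α(x) dμ(x)` of the image under `Z` of the complex
measure `α dμ`. -/
noncomputable def weightedFourier (μ : Measure Ω) (Z : Ω → E) (α : Ω → ℂ) (ξ : E) : ℂ :=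
  ∫ x, 𝐞 (-⟪ξ, Z x⟫) • α x ∂μ

omit [FiniteDimensional ℝ E] [MeasurableSpace E] [BorelSpace E] in
lemma norm_weightedFourier_le (μ : Measure Ω) (Z : Ω → E) (α : Ω → ℂ) (ξ : E) :
    ‖weightedFourier μ Z α ξ‖ ≤ ∫ x, ‖α x‖ ∂μ := by
  refine (norm_integral_le_integral_norm _).trans (le_of_eq ?_)
  simp

lemma measurable_fourierChar_inner (hZ : Measurable Z) :
    Measurable (fun p : Ω × E => ((𝐞 ⟪p.2, Z p.1⟫ : Circle) : ℂ)) := by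
  have h : Continuous (fun q : E × E => ((𝐞 ⟪q.2, q.1⟫ : Circle) : ℂ)) :=
    continuous_subtype_val.comp (Real.continuous_fourierChar.comp (by fun_prop))
  exact h.measurable.comp ((hZ.comp measurable_fst).prodMk measurable_snd)

lemma aestronglyMeasurable_weightedFourier [SFinite μ] (hZ : Measurable Z)
    (hα : AEStronglyMeasurable α μ) :
    AEStronglyMeasurable (weightedFourier μ Z α) := by
  have h1 : Measurable (fun p : E × Ω => ((𝐞 (-⟪p.1, Z p.2⟫) : Circle) : ℂ)) := by
    have h : Continuous (fun q : E × E => ((𝐞 (-⟪q.1, q.2⟫) : Circle) : ℂ)) :=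
      continuous_subtype_val.comp (Real.continuous_fourierChar.comp (by fun_prop))
    exact h.measurable.comp (measurable_fst.prodMk (hZ.comp measurable_snd))
  exact (h1.aestronglyMeasurable.mul hα.comp_snd).integral_prod_right'

/-- By Fubini, the evaluation of `𝓕⁻ φ` along `Z` is adjoint to `weightedFourier`. -/
lemma integral_conj_mul_fourierInv [SFinite μ] (hZ : Measurable Z) (hα : Integrable α μ)
    {φ : E → ℂ} (hφ : Integrable φ) :
    ∫ x, conj (α x) * 𝓕⁻ φ (Z x) ∂μ = ∫ ξ, φ ξ * conj (weightedFourier μ Z α ξ) := by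
  have hint : Integrable (fun p : Ω × E => conj (α p.1) * (𝐞 ⟪p.2, Z p.1⟫ • φ p.2))
      (μ.prod volume) := by
    have h := ((integrable_conj hα).mul_prod hφ).bdd_mul (c := 1)
      (measurable_fourierChar_inner hZ).aestronglyMeasurable
      (Eventually.of_forall fun p => (Circle.norm_coe _).le)
    refine h.congr (Eventually.of_forall fun p => ?_)
    simp only [Circle.smul_def, smul_eq_mul]
    ring
  calc ∫ x, conj (α x) * 𝓕⁻ φ (Z x) ∂μ
      = ∫ x, (∫ ξ, conj (α x) * (𝐞 ⟪ξ, Z x⟫ • φ ξ)) ∂μ := by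
        simp_rw [Real.fourierInv_eq, integral_const_mul]
    _ = ∫ ξ, ∫ x, conj (α x) * (𝐞 ⟪ξ, Z x⟫ • φ ξ) ∂μ := integral_integral_swap hint
    _ = _ := by
        refine integral_congr_ae (Eventually.of_forall fun ξ => ?_)
        simp only [weightedFourier]
        rw [← integral_conj, ← integral_const_mul]
        refine integral_congr_ae (Eventually.of_forall fun x => ?_)
        simp only [Circle.smul_def, smul_eq_mul, map_mul, AddChar.map_neg_eq_inv,
          Circle.coe_inv_eq_conj, Complex.conj_conj]
        ring

lemma integrable_mul_weightedFourier [SFinite μ] (hZ : Measurable Z)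
    (hα : AEStronglyMeasurable α μ) {φ : E → ℂ} (hφ : Integrable φ) :
    Integrable (fun ξ => φ ξ * weightedFourier μ Z α ξ) :=
  hφ.mul_bdd (aestronglyMeasurable_weightedFourier hZ hα)
    (Eventually.of_forall (norm_weightedFourier_le μ Z α))

/-- The function with Fourier transform `k · weightedFourier α`, evaluated along `Z`, is the
kernel integral operator applied to `α`. -/
lemma fourierInv_mul_weightedFourier [SFinite μ] (hk : AEMeasurable k) (hfin : ∫⁻ ξ, k ξ ≠ ∞)
    (hZ : Measurable Z) (hα : Integrable α μ) (x : Ω) :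
    𝓕⁻ (fun ξ => ((k ξ).toReal : ℂ) * weightedFourier μ Z α ξ) (Z x) =
      integralOp (pullbackKernel k Z) μ α x := by
  have hkint := integrable_ofReal_toReal hk hfin
  -- The pairing with `φ(ξ) = k(ξ) e^{-2πi⟨ξ, Z x⟩}`, whose inverse transform is `K(· - Z x)`.
  have hφ : Integrable (fun ξ => 𝐞 (-⟪ξ, Z x⟫) • ((k ξ).toReal : ℂ)) :=
    (Real.fourierIntegral_convergent_iff (Z x)).2 hkint
  have h := congrArg conj (integral_conj_mul_fourierInv hZ hα hφ)
  rw [← integral_conj, ← integral_conj] at h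
  rw [Real.fourierInv_eq, integralOp]
  convert h.symm using 1
  · refine integral_congr_ae (Eventually.of_forall fun ξ => ?_)
    simp only [Circle.smul_def, smul_eq_mul, map_mul, AddChar.map_neg_eq_inv,
      Circle.coe_inv_eq_conj, Complex.conj_conj, Complex.conj_ofReal]
    ring
  · refine integral_congr_ae (Eventually.of_forall fun x' => ?_)
    simp only [map_mul, Complex.conj_conj]
    rw [mul_comm]
    congr 1
    have : 𝓕⁻ (fun ξ => 𝐞 (-⟪ξ, Z x⟫) • ((k ξ).toReal : ℂ)) (Z x') =
        spectralKernel k (Z x' - Z x) := by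
      rw [spectralKernel, Real.fourierInv_eq, Real.fourierInv_eq]
      refine integral_congr_ae (Eventually.of_forall fun ξ => ?_)
      simp only [smul_smul, inner_sub_right]
      rw [← AddChar.map_add_eq_mul, ← sub_eq_add_neg]
    rw [this, conj_spectralKernel, pullbackKernel, neg_sub]

lemma energy_pullbackKernel [SFinite μ] (hk : AEMeasurable k) (hfin : ∫⁻ ξ, k ξ ≠ ∞)
    (hZ : Measurable Z) (hα : Integrable α μ) :
    energy (pullbackKernel k Z) μ α = ∫ ξ, (k ξ).toReal * ‖weightedFourier μ Z α ξ‖ ^ 2 := by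
  have h := integral_conj_mul_fourierInv hZ hα
    (integrable_mul_weightedFourier hZ hα.1 (integrable_ofReal_toReal hk hfin))
  simp_rw [fourierInv_mul_weightedFourier hk hfin hZ hα] at h
  rw [energy, h, ← RCLike.re_eq_complex_re, ← integral_re]
  · refine integral_congr_ae (Eventually.of_forall fun ξ => ?_)
    simp only [mul_assoc, Complex.mul_conj', RCLike.re_eq_complex_re]
    norm_cast
  · exact (integrable_mul_weightedFourier hZ hα.1 (integrable_ofReal_toReal hk hfin)).mul_bdd
      (aestronglyMeasurable_weightedFourier hZ hα.1).star
      (Eventually.of_forall fun ξ => by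
        rw [Complex.norm_conj]; exact norm_weightedFourier_le μ Z α ξ)

lemma energy_pullbackKernel_nonneg [SFinite μ] (hk : AEMeasurable k) (hfin : ∫⁻ ξ, k ξ ≠ ∞)
    (hZ : Measurable Z) (hα : Integrable α μ) : 0 ≤ energy (pullbackKernel k Z) μ α := by
  rw [energy_pullbackKernel hk hfin hZ hα]
  exact integral_nonneg fun ξ => by positivity

lemma integrable_toReal_mul_norm_weightedFourier_sq [SFinite μ] (hk : AEMeasurable k)
    (hfin : ∫⁻ ξ, k ξ ≠ ∞) (hZ : Measurable Z) (hα : Integrable α μ) :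
    Integrable (fun ξ => (k ξ).toReal * ‖weightedFourier μ Z α ξ‖ ^ 2) :=
  (integrable_toReal_of_lintegral_ne_top hk hfin).mul_bdd (c := (∫ x, ‖α x‖ ∂μ) ^ 2)
    ((aestronglyMeasurable_weightedFourier hZ hα.1).norm.pow 2)
    (Eventually.of_forall fun ξ => by
      rw [norm_pow, norm_norm]
      exact pow_le_pow_left₀ (norm_nonneg _) (norm_weightedFourier_le μ Z α ξ) 2)

lemma loss_nonneg (k : E → ℝ≥0∞) (μ : Measure Ω) (Z : Ω → E) (Y : Ω → ℂ) {lam : ℝ}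
    (hlam : 0 < lam) (f : E → ℂ) : 0 ≤ loss k μ Z Y lam f := by
  have : 0 ≤ ∫ ω, ‖Y ω - f (Z ω)‖ ^ 2 ∂μ := integral_nonneg fun _ => by positivity
  unfold loss
  positivity

lemma bddBelow_range_loss (k : E → ℝ≥0∞) (μ : Measure Ω) (Z : Ω → E) (Y : Ω → ℂ) {lam : ℝ}
    (hlam : 0 < lam) : BddBelow (Set.range fun f : space k => loss k μ Z Y lam f) :=
  ⟨0, by rintro _ ⟨f, rfl⟩; exact loss_nonneg k μ Z Y hlam f⟩

lemma normSq_zero (k : E → ℝ≥0∞) : normSq k (0 : E → ℂ) = 0 := by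
  refine le_antisymm ((iInf₂_le (0 : E → ℂ) ⟨integrable_zero _ _ _, fun x => ?_⟩).trans ?_) bot_le
  · simp
  · simp only [Real.fourierInv_eq, Pi.zero_apply, smul_zero, integral_zero]

instance instNonemptySpace (k : E → ℝ≥0∞) : Nonempty (space k) :=
  ⟨⟨0, by simp [space, normSq_zero]⟩⟩

/-- The squared norm of the function with Fourier transform `c k · weightedFourier α`. -/
lemma normSq_fourierInv_le [SFinite μ] (hk : AEMeasurable k) (hfin : ∫⁻ ξ, k ξ ≠ ∞)
    (hZ : Measurable Z) (hα : Integrable α μ) (c : ℂ) :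
    normSq k (𝓕⁻ (fun ξ => c * (((k ξ).toReal : ℂ) * weightedFourier μ Z α ξ))) ≤
      ENNReal.ofReal (‖c‖ ^ 2 * energy (pullbackKernel k Z) μ α) := by
  refine (iInf₂_le _ ⟨(integrable_mul_weightedFourier hZ hα.1
    (integrable_ofReal_toReal hk hfin)).const_mul c, fun x => rfl⟩).trans ?_
  rw [energy_pullbackKernel hk hfin hZ hα, ← integral_const_mul,
    ofReal_integral_eq_lintegral_ofReal
      ((integrable_toReal_mul_norm_weightedFourier_sq hk hfin hZ hα).const_mul _)
      (Eventually.of_forall fun ξ => by positivity)]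
  refine lintegral_mono_ae ?_
  filter_upwards [ae_lt_top' hk hfin] with ξ hξ
  rw [← ofReal_norm, ← ENNReal.ofReal_pow (norm_nonneg _)]
  refine ENNReal.div_le_of_le_mul ?_
  nth_rewrite 3 [← ENNReal.ofReal_toReal hξ.ne]
  rw [← ENNReal.ofReal_mul (by positivity)]
  refine ENNReal.ofReal_le_ofReal (le_of_eq ?_)
  simp only [norm_mul, Complex.norm_real, Real.norm_of_nonneg ENNReal.toReal_nonneg]
  ring

/-- Primal bound: the value is at most the loss of the function `Gα / lam`. -/
lemma value_le [IsFiniteMeasure μ] (hk : AEMeasurable k) (hfin : ∫⁻ ξ, k ξ ≠ ∞)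
    (hZ : Measurable Z) {lam : ℝ} (hlam : 0 < lam) (hα : Integrable α μ) :
    value k μ Z Y lam ≤
      1 / 2 * ∫ x, ‖Y x - ((lam⁻¹ : ℝ) : ℂ) * integralOp (pullbackKernel k Z) μ α x‖ ^ 2 ∂μ +
        1 / (2 * lam) * energy (pullbackKernel k Z) μ α := by
  have hN := normSq_fourierInv_le hk hfin hZ hα ((lam⁻¹ : ℝ) : ℂ)
  set f : E → ℂ := 𝓕⁻ (fun ξ => ((lam⁻¹ : ℝ) : ℂ) * (((k ξ).toReal : ℂ) *
    weightedFourier μ Z α ξ)) with hf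
  have hf' (x : Ω) : f (Z x) =
      ((lam⁻¹ : ℝ) : ℂ) * integralOp (pullbackKernel k Z) μ α x := by
    rw [hf, ← fourierInv_mul_weightedFourier hk hfin hZ hα, Real.fourierInv_eq,
      Real.fourierInv_eq, ← integral_const_mul]
    refine integral_congr_ae (Eventually.of_forall fun ξ => ?_)
    simp only [Circle.smul_def, smul_eq_mul]
    ring
  have hfs : f ∈ space k := hN.trans_lt ENNReal.ofReal_lt_top
  refine (ciInf_le (bddBelow_range_loss k μ Z Y hlam) ⟨f, hfs⟩).trans ?_
  simp only [loss, hf']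
  have hE := energy_pullbackKernel_nonneg hk hfin hZ hα
  have h2 : (normSq k f).toReal ≤ lam⁻¹ ^ 2 * energy (pullbackKernel k Z) μ α := by
    refine ENNReal.toReal_le_of_le_ofReal (by positivity) (hN.trans_eq ?_)
    rw [Complex.norm_real, Real.norm_of_nonneg (by positivity)]
  have h3 : lam / 2 * (lam⁻¹ ^ 2 * energy (pullbackKernel k Z) μ α) =
      1 / (2 * lam) * energy (pullbackKernel k Z) μ α := by
    field_simp
  rw [← h3]
  gcongr

/-- Fenchel–Young inequality on the frequency side, in the duality between `∫ |φ|² / k` and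
`∫ k |a|²`. -/
lemma re_integral_mul_weightedFourier_le [SFinite μ] (hk : AEMeasurable k)
    (hfin : ∫⁻ ξ, k ξ ≠ ∞) (hk0 : ∀ᵐ ξ, k ξ ≠ 0) (hZ : Measurable Z) {lam : ℝ} (hlam : 0 < lam)
    (hα : Integrable α μ) {φ : E → ℂ} (hφ : Integrable φ)
    (hφk : ∫⁻ ξ, ‖φ ξ‖ₑ ^ 2 / k ξ ≠ ∞) :
    (∫ ξ, φ ξ * conj (weightedFourier μ Z α ξ)).re ≤
      lam / 2 * (∫⁻ ξ, ‖φ ξ‖ₑ ^ 2 / k ξ).toReal +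
        1 / (2 * lam) * energy (pullbackKernel k Z) μ α := by
  have hm : AEMeasurable (fun ξ => ‖φ ξ‖ₑ ^ 2 / k ξ) := (hφ.1.enorm.pow_const 2).div hk
  have hi1 := integrable_toReal_of_lintegral_ne_top hm hφk
  have hi2 := integrable_toReal_mul_norm_weightedFourier_sq hk hfin hZ hα
  rw [energy_pullbackKernel hk hfin hZ hα, ← integral_toReal hm (ae_lt_top' hm hφk),
    ← integral_const_mul, ← integral_const_mul, ← integral_add (hi1.const_mul _) (hi2.const_mul _)]
  refine (Complex.re_le_norm _).trans ?_
  refine norm_integral_le_of_norm_le ((hi1.const_mul _).add (hi2.const_mul _)) ?_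
  filter_upwards [ae_lt_top' hk hfin, hk0] with ξ hξ hξ0
  have hpos : 0 < (k ξ).toReal := ENNReal.toReal_pos hξ0 hξ.ne
  rw [norm_mul, Complex.norm_conj, ENNReal.toReal_div, ENNReal.toReal_pow, toReal_enorm]
  set p := ‖φ ξ‖
  set q := ‖weightedFourier μ Z α ξ‖
  set r := (k ξ).toReal
  have : lam / 2 * (p ^ 2 / r) + 1 / (2 * lam) * (r * q ^ 2) - p * q =
      (lam * p - r * q) ^ 2 / (2 * lam * r) := by
    field_simp
    ring
  have h0 : 0 ≤ (lam * p - r * q) ^ 2 / (2 * lam * r) := by positivity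
  linarith

/-- Dual bound: every `α ∈ L²` gives a lower bound for the value. -/
lemma le_value [IsFiniteMeasure μ] (hk : AEMeasurable k) (hfin : ∫⁻ ξ, k ξ ≠ ∞)
    (hk0 : ∀ᵐ ξ, k ξ ≠ 0) (hZ : Measurable Z) {lam : ℝ} (hlam : 0 < lam) (hα : MemLp α 2 μ)
    (hY : MemLp Y 2 μ) :
    (∫ x, conj (α x) * Y x ∂μ).re - 1 / 2 * ∫ x, ‖α x‖ ^ 2 ∂μ -
        1 / (2 * lam) * energy (pullbackKernel k Z) μ α ≤ value k μ Z Y lam := by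
  refine le_ciInf fun ⟨f, hf⟩ => ?_
  have hα1 : Integrable α μ := hα.integrable (by norm_num)
  simp only [loss]
  -- It suffices to bound by the penalty of each Fourier transform of `f` separately.
  suffices h : ∀ φ : E → ℂ, IsFourierTransformOf φ f → ∫⁻ ξ, ‖φ ξ‖ₑ ^ 2 / k ξ ≠ ∞ →
      (∫ x, conj (α x) * Y x ∂μ).re - 1 / 2 * ∫ x, ‖α x‖ ^ 2 ∂μ -
        1 / (2 * lam) * energy (pullbackKernel k Z) μ α ≤
      1 / 2 * ∫ x, ‖Y x - f (Z x)‖ ^ 2 ∂μ + lam / 2 * (∫⁻ ξ, ‖φ ξ‖ₑ ^ 2 / k ξ).toReal by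
    set L := (∫ x, conj (α x) * Y x ∂μ).re - 1 / 2 * ∫ x, ‖α x‖ ^ 2 ∂μ -
        1 / (2 * lam) * energy (pullbackKernel k Z) μ α
    set R := 1 / 2 * ∫ x, ‖Y x - f (Z x)‖ ^ 2 ∂μ
    have h1 : ENNReal.ofReal ((L - R) / (lam / 2)) ≤ normSq k f := by
      refine le_iInf₂ fun φ hφ => ?_
      by_cases htop : ∫⁻ ξ, ‖φ ξ‖ₑ ^ 2 / k ξ = ∞
      · rw [htop]; exact le_top
      · refine ENNReal.ofReal_le_of_le_toReal ?_
        have := h φ hφ htop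
        rw [div_le_iff₀ (by positivity)]
        linarith
    have h2 := (ENNReal.ofReal_le_iff_le_toReal (ne_of_lt hf)).1 h1
    rw [div_le_iff₀ (by positivity)] at h2
    linarith
  intro φ hφ htop
  have hfZ : MemLp (fun x => f (Z x)) 2 μ := by
    have : (fun x => f (Z x)) = fun x => 𝓕⁻ φ (Z x) := funext fun x => hφ.2 _
    rw [this]
    exact MemLp.of_bound
      ((continuous_fourierInv hφ.1).measurable.comp hZ).aestronglyMeasurable _
      (Eventually.of_forall fun x => norm_fourierInv_le φ (Z x))
  have h1 := re_integral_mul_weightedFourier_le hk hfin hk0 hZ hlam hα1 hφ.1 htop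
  rw [← integral_conj_mul_fourierInv hZ hα1 hφ.1] at h1
  simp_rw [← hφ.2] at h1
  have hiY : Integrable (fun x => conj (α x) * Y x) μ := (memLp_conj hα).integrable_mul hY
  have hif : Integrable (fun x => conj (α x) * f (Z x)) μ := (memLp_conj hα).integrable_mul hfZ
  have h2 : (∫ x, conj (α x) * Y x ∂μ).re - (∫ x, conj (α x) * f (Z x) ∂μ).re ≤
      1 / 2 * ∫ x, ‖Y x - f (Z x)‖ ^ 2 ∂μ + 1 / 2 * ∫ x, ‖α x‖ ^ 2 ∂μ := by
    have i1 := (hY.sub hfZ).norm.integrable_sq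
    have i2 := hα.norm.integrable_sq
    simp only [Pi.sub_apply] at i1
    rw [← Complex.sub_re, ← integral_sub hiY hif, ← integral_const_mul, ← integral_const_mul,
      ← integral_add (i1.const_mul _) (i2.const_mul _)]
    refine (Complex.re_le_norm _).trans ?_
    refine norm_integral_le_of_norm_le ((i1.const_mul _).add (i2.const_mul _))
      (Eventually.of_forall fun x => ?_)
    rw [← mul_sub, norm_mul, Complex.norm_conj]
    nlinarith [sq_nonneg (‖α x‖ - ‖Y x - f (Z x)‖)]
  linarith

end Spectral

/-! ### Primal and dual objectives at a solution of the resolvent equation -/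

section Optimality

variable {Ω : Type*} [MeasurableSpace Ω] {μ : Measure Ω} {κ : Ω → Ω → ℂ} {α Y : Ω → ℂ} {lam : ℝ}

lemma integral_conj_mul_self (α : Ω → ℂ) :
    ∫ x, conj (α x) * α x ∂μ = ((∫ x, ‖α x‖ ^ 2 ∂μ : ℝ) : ℂ) := by
  rw [← integral_complex_ofReal]
  refine integral_congr_ae (Eventually.of_forall fun x => ?_)
  simp [Complex.conj_mul']

lemma energy_eq_of_add_integralOp_eq (hα : MemLp α 2 μ) (hY : MemLp Y 2 μ)
    (h : ∀ᵐ x ∂μ, (lam : ℂ) * α x + integralOp κ μ α x = lam * Y x) :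
    energy κ μ α = lam * (∫ x, conj (α x) * Y x ∂μ).re - lam * ∫ x, ‖α x‖ ^ 2 ∂μ := by
  have hiY : Integrable (fun x => conj (α x) * Y x) μ := (memLp_conj hα).integrable_mul hY
  have hiα : Integrable (fun x => conj (α x) * α x) μ := (memLp_conj hα).integrable_mul hα
  have : ∫ x, conj (α x) * integralOp κ μ α x ∂μ =
      lam * ∫ x, conj (α x) * Y x ∂μ - lam * ∫ x, conj (α x) * α x ∂μ := by
    rw [← integral_const_mul, ← integral_const_mul,
      ← integral_sub (hiY.const_mul _) (hiα.const_mul _)]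
    refine integral_congr_ae ?_
    filter_upwards [h] with x hx
    rw [← sub_eq_iff_eq_add'.2 hx.symm]
    ring
  rw [energy, this, integral_conj_mul_self, Complex.sub_re, Complex.re_ofReal_mul,
    Complex.re_ofReal_mul, Complex.ofReal_re]

/-- The dual objective at a solution of `(lam + G) α = lam Y`. -/
lemma dual_eq_of_add_integralOp_eq (hlam : 0 < lam) (hα : MemLp α 2 μ) (hY : MemLp Y 2 μ)
    (h : ∀ᵐ x ∂μ, (lam : ℂ) * α x + integralOp κ μ α x = lam * Y x) :
    (∫ x, conj (α x) * Y x ∂μ).re - 1 / 2 * ∫ x, ‖α x‖ ^ 2 ∂μ - 1 / (2 * lam) * energy κ μ α =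
      1 / 2 * (∫ x, conj (α x) * Y x ∂μ).re := by
  rw [energy_eq_of_add_integralOp_eq hα hY h]
  field_simp
  ring

/-- The primal objective at a solution of `(lam + G) α = lam Y`: the residual of `Gα / lam`
is `α`. -/
lemma primal_eq_of_add_integralOp_eq (hlam : 0 < lam) (hα : MemLp α 2 μ) (hY : MemLp Y 2 μ)
    (h : ∀ᵐ x ∂μ, (lam : ℂ) * α x + integralOp κ μ α x = lam * Y x) :
    1 / 2 * ∫ x, ‖Y x - ((lam⁻¹ : ℝ) : ℂ) * integralOp κ μ α x‖ ^ 2 ∂μ +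
        1 / (2 * lam) * energy κ μ α =
      1 / 2 * (∫ x, conj (α x) * Y x ∂μ).re := by
  have : ∫ x, ‖Y x - ((lam⁻¹ : ℝ) : ℂ) * integralOp κ μ α x‖ ^ 2 ∂μ = ∫ x, ‖α x‖ ^ 2 ∂μ := by
    refine integral_congr_ae ?_
    filter_upwards [h] with x hx
    have hl : (lam : ℂ) ≠ 0 := by exact_mod_cast hlam.ne'
    have : Y x - ((lam⁻¹ : ℝ) : ℂ) * integralOp κ μ α x = α x := by
      rw [Complex.ofReal_inv]
      field_simp
      linear_combination -hx
    rw [this]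
  rw [this, energy_eq_of_add_integralOp_eq hα hY h]
  field_simp
  ring

end Optimality

/-! ### Strong duality and continuity of the value -/

section Value

variable {E : Type*} [NormedAddCommGroup E] [InnerProductSpace ℝ E] [FiniteDimensional ℝ E]
  [MeasurableSpace E] [BorelSpace E] {k : E → ℝ≥0∞}
  {Ω : Type*} [MeasurableSpace Ω] {μ : Measure Ω} [IsFiniteMeasure μ] {Z : Ω → E} {α Y : Ω → ℂ}
  {lam : ℝ}

/-- Strong duality: the value in terms of the solution of `(lam + G) α = lam Y`. -/
lemma value_eq (hk : AEMeasurable k) (hfin : ∫⁻ ξ, k ξ ≠ ∞)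
    (hk0 : ∀ᵐ ξ, k ξ ≠ 0) (hZ : Measurable Z) (hlam : 0 < lam) (hα : MemLp α 2 μ)
    (hY : MemLp Y 2 μ)
    (h : ∀ᵐ x ∂μ, (lam : ℂ) * α x + integralOp (pullbackKernel k Z) μ α x = lam * Y x) :
    value k μ Z Y lam = 1 / 2 * (∫ x, conj (α x) * Y x ∂μ).re := by
  refine le_antisymm ?_ ?_
  · rw [← primal_eq_of_add_integralOp_eq hlam hα hY h]
    exact value_le hk hfin hZ hlam (hα.integrable (by norm_num))
  · rw [← dual_eq_of_add_integralOp_eq hlam hα hY h]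
    exact le_value hk hfin hk0 hZ hlam hα hY

/-- If the kernels of a sequence of problems converge pointwise to `κ`, whose operator is `G`, then
`(lam + G) α = lam Y` is solvable and the values converge to `½ Re ⟨α, Y⟩`. -/
lemma exists_tendsto_value (hk : AEMeasurable k) (hfin : ∫⁻ ξ, k ξ ≠ ∞)
    (hk0 : ∀ᵐ ξ, k ξ ≠ 0) {Zs : ℕ → Ω → E} (hZ : ∀ n, Measurable (Zs n)) {κ : Ω → Ω → ℂ}
    (hlim : ∀ x x', Tendsto (fun n => pullbackKernel k (Zs n) x x') atTop (𝓝 (κ x x')))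
    (hlam : 0 < lam) (hY : MemLp Y 2 μ) :
    ∃ α, MemLp α 2 μ ∧ (∀ᵐ x ∂μ, (lam : ℂ) * α x + integralOp κ μ α x = lam * Y x) ∧
      Tendsto (fun n => value k μ (Zs n) Y lam) atTop
        (𝓝 (1 / 2 * (∫ x, conj (α x) * Y x ∂μ).re)) := by
  have hm n := stronglyMeasurable_pullbackKernel hk hfin (hZ n)
  have hb n := norm_pullbackKernel_le k (Zs n)
  -- Measurability, boundedness and positivity of `κ` are inherited from the sequence.
  have hκ : StronglyMeasurable (Function.uncurry κ) :=
    stronglyMeasurable_of_tendsto atTop hm (tendsto_pi_nhds.2 fun p => hlim p.1 p.2)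
  have hκb x x' : ‖κ x x'‖ ≤ ∫ ξ, (k ξ).toReal :=
    le_of_tendsto' (hlim x x').norm fun n => hb n x x'
  obtain ⟨α, hα, h⟩ := exists_add_integralOp_eq hκ hκb (fun β hβ =>
    ge_of_tendsto' (tendsto_energy hm hb hlim (hβ.integrable (by norm_num))) fun n =>
      energy_pullbackKernel_nonneg hk hfin (hZ n) (hβ.integrable (by norm_num))) hlam hY
  refine ⟨α, hα, h, ?_⟩
  have hα1 : Integrable α μ := hα.integrable (by norm_num)
  have hE := (tendsto_energy hm hb hlim hα1).const_mul (1 / (2 * lam))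
  refine tendsto_of_tendsto_of_tendsto_of_le_of_le ?_ ?_
    (fun n => le_value hk hfin hk0 (hZ n) hlam hα hY)
    (fun n => value_le hk hfin (hZ n) hlam hα1)
  · rw [← dual_eq_of_add_integralOp_eq hlam hα hY h]
    exact hE.const_sub _
  · rw [← primal_eq_of_add_integralOp_eq hlam hα hY h]
    exact ((tendsto_integral_sq_sub_integralOp hm hb hlim hα1 hY _).const_mul _).add hE

end Value

/-! ### Orthogonal decomposition and the reduced density -/

section Decomposition

variable {V : Type*} [NormedAddCommGroup V] [InnerProductSpace ℝ V] [FiniteDimensional ℝ V]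

/-- An operator with vanishing entry `W → Wᗮ` acts on a vector of `W` through its `W`-block. -/
lemma apply_eq_block (W : Submodule ℝ V) {U : V →L[ℝ] V} (hU : block W Wᗮ U = 0) {v : V}
    (hv : Wᗮ.orthogonalProjectionOnto v = 0) :
    U v = (block W W U (W.orthogonalProjectionOnto v) : V) := by
  have h1 : ((W.orthogonalProjectionOnto v : W) : V) = v := by
    have := W.starProjection_add_starProjection_orthogonal v
    simp only [Submodule.starProjection_apply] at this
    rwa [hv, Submodule.coe_zero, add_zero] at this
  have h2 : Wᗮ.orthogonalProjectionOnto (U v) = 0 := by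
    have := DFunLike.congr_fun hU (W.orthogonalProjectionOnto v)
    simpa [block, h1] using this
  have h3 := W.starProjection_add_starProjection_orthogonal (U v)
  simp only [Submodule.starProjection_apply] at h3
  rw [h2, Submodule.coe_zero, add_zero] at h3
  rw [← h3]
  simp [block, h1]

/-- The `Wᗮ`-block of an operator with vanishing entry `W → Wᗮ` is dominated by the operator. -/
lemma norm_block_orthogonal_le (W : Submodule ℝ V) {U : V →L[ℝ] V} (hU : block W Wᗮ U = 0)
    (v : V) : ‖block Wᗮ Wᗮ U (Wᗮ.orthogonalProjectionOnto v)‖ ≤ ‖U v‖ := by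
  have h1 : Wᗮ.orthogonalProjectionOnto (U v) =
      block Wᗮ Wᗮ U (Wᗮ.orthogonalProjectionOnto v) := by
    have h2 := DFunLike.congr_fun hU (W.orthogonalProjectionOnto v)
    have h3 := W.starProjection_add_starProjection_orthogonal v
    simp only [Submodule.starProjection_apply] at h3
    simp only [block, ContinuousLinearMap.comp_apply, Submodule.subtypeL_apply,
      zero_apply] at h2 ⊢
    conv_lhs => rw [← h3, map_add, map_add, h2, zero_add]
  rw [← h1]
  exact Wᗮ.norm_orthogonalProjectionOnto_apply_le _

variable [MeasurableSpace V] [BorelSpace V]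

lemma measurePreserving_add (W : Submodule ℝ V) :
    MeasurePreserving (fun q : W × Wᗮ => (q.1 : V) + (q.2 : V)) := by
  have h := W.orthogonalDecomposition.symm.measurePreserving.comp
    (WithLp.volume_preserving_toLp W Wᗮ)
  refine ⟨by fun_prop, ?_⟩
  rw [← h.map_eq]
  congr 1

variable {kV : V → ℝ}

lemma aemeasurable_density (hk : Integrable kV) : AEMeasurable (density kV) :=
  hk.1.aemeasurable.ennreal_ofReal

lemma lintegral_density_ne_top (hk : Integrable kV) : ∫⁻ ω, density kV ω ≠ ∞ :=
  hk.lintegral_lt_top.ne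

lemma aemeasurable_density_add (W : Submodule ℝ V) (hk : Integrable kV) :
    AEMeasurable (fun q : W × Wᗮ => density kV ((q.1 : V) + (q.2 : V))) :=
  (aemeasurable_density hk).comp_quasiMeasurePreserving
    (measurePreserving_add W).quasiMeasurePreserving

lemma aemeasurable_reducedDensity (W : Submodule ℝ V) (hk : Integrable kV) :
    AEMeasurable (reducedDensity kV W) :=
  (aemeasurable_density_add W hk).lintegral_prod_right'

lemma lintegral_reducedDensity (W : Submodule ℝ V) (hk : Integrable kV) :
    ∫⁻ η, reducedDensity kV W η = ∫⁻ ω, density kV ω := by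
  have h := lintegral_prod _ (aemeasurable_density_add W hk)
  rw [← (measurePreserving_add W).map_eq, lintegral_map' _ (measurePreserving_add W).aemeasurable]
  · exact h.symm
  · rw [(measurePreserving_add W).map_eq]
    exact aemeasurable_density hk

lemma lintegral_reducedDensity_ne_top (W : Submodule ℝ V) (hk : Integrable kV) :
    ∫⁻ η, reducedDensity kV W η ≠ ∞ := by
  rw [lintegral_reducedDensity W hk]
  exact lintegral_density_ne_top hk

/-- The reduced density is positive almost everywhere. (On the null set of `η` where the slice
`kV (η + ·)` is not measurable, its lower integral may vanish.) -/
lemma ae_reducedDensity_ne_zero (W : Submodule ℝ V) (hk : Integrable kV) (hpos : ∀ ω, 0 < kV ω) :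
    ∀ᵐ η, reducedDensity kV W η ≠ 0 := by
  have hm := (aemeasurable_density_add W hk).aestronglyMeasurable.prodMk_left
  filter_upwards [hm] with η hη h0
  rw [reducedDensity, lintegral_eq_zero_iff' hη.aemeasurable] at h0
  obtain ⟨ξ, hξ⟩ := h0.exists
  exact (ENNReal.ofReal_pos.2 (hpos _)).ne' hξ

/-- The kernel with the reduced density is the restriction of the kernel to `W`. -/
lemma spectralKernel_reducedDensity (W : Submodule ℝ V) (hk : Integrable kV) (w : W) :
    spectralKernel (reducedDensity kV W) w = spectralKernel (density kV) (w : V) := by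
  have hint : Integrable (fun v => 𝐞 ⟪v, (w : V)⟫ • ((density kV v).toReal : ℂ)) := by
    have := (Real.fourierIntegral_convergent_iff (-(w : V))).2
      (integrable_ofReal_toReal (aemeasurable_density hk) (lintegral_density_ne_top hk))
    simpa using this
  have hint2 := (measurePreserving_add W).integrable_comp_of_integrable hint
  rw [spectralKernel, spectralKernel, Real.fourierInv_eq, Real.fourierInv_eq,
    ← (measurePreserving_add W).map_eq, integral_map (measurePreserving_add W).aemeasurable]
  · refine Eq.trans (integral_congr_ae ?_) (integral_prod _ hint2).symm
    have hm := (aemeasurable_density_add W hk).aestronglyMeasurable.prodMk_left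
    filter_upwards [hm] with η hη
    have h1 : ((reducedDensity kV W η).toReal : ℂ) =
        ∫ ξ : Wᗮ, ((density kV ((η : V) + (ξ : V))).toReal : ℂ) := by
      rw [integral_complex_ofReal, integral_toReal hη.aemeasurable
        (Eventually.of_forall fun ξ => ENNReal.ofReal_lt_top), reducedDensity]
    rw [h1, Circle.smul_def, ← integral_smul]
    refine integral_congr_ae (Eventually.of_forall fun ξ => ?_)
    have h2 : ⟪(ξ : V), (w : V)⟫ = 0 := Submodule.inner_left_of_mem_orthogonal w.2 ξ.2
    simp only [Function.comp_apply, Circle.smul_def, inner_add_left, h2, add_zero,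
      Submodule.coe_inner]
  · rw [(measurePreserving_add W).map_eq]
    exact hint.1

end Decomposition

/-! ### The limit kernel -/

section SliceKernel

variable {V : Type*} [NormedAddCommGroup V] [InnerProductSpace ℝ V] [FiniteDimensional ℝ V]
  [MeasurableSpace V] [BorelSpace V] {Ω : Type*} {kV : V → ℝ} {W : Submodule ℝ V}
  {X : Ω → V} {T : W →L[ℝ] W}

open Classical in
/-- The limit kernel: `K_W(T X_W - T X'_W)` if `X_{W'} = X'_{W'}`, and `0` otherwise. -/
noncomputable def sliceKernel (kV : V → ℝ) (W : Submodule ℝ V) (X : Ω → V) (T : W →L[ℝ] W)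
    (x x' : Ω) : ℂ :=
  if perpPart W X x' = perpPart W X x then
    pullbackKernel (reducedDensity kV W) (fun ω => T (W.orthogonalProjectionOnto (X ω))) x x'
  else 0

/-- The kernels of the problems with parameters `U n` converge to the slice kernel. Off the
diagonal of `X_{W'}` this is the Riemann–Lebesgue lemma. -/
lemma tendsto_pullbackKernel_sliceKernel (hk : Integrable kV) {U : ℕ → V →L[ℝ] V} {Λ : ℕ → ℝ}
    (hU11 : Tendsto (fun n => block W W (U n)) atTop (𝓝 T))
    (hU21 : ∀ n, block W Wᗮ (U n) = 0)
    (hU22 : ∀ n, ∀ x : Wᗮ, Λ n * ‖x‖ ≤ ‖block Wᗮ Wᗮ (U n) x‖)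
    (hΛ : Tendsto Λ atTop atTop) (x x' : Ω) :
    Tendsto (fun n => pullbackKernel (density kV) (fun ω => U n (X ω)) x x') atTop
      (𝓝 (sliceKernel kV W X T x x')) := by
  simp only [pullbackKernel, sliceKernel, ← map_sub]
  set v := X x - X x'
  split_ifs with h
  · have hv : Wᗮ.orthogonalProjectionOnto v = 0 := by
      rw [map_sub, sub_eq_zero]
      exact h.symm
    simp_rw [apply_eq_block W (hU21 _) hv, ← spectralKernel_reducedDensity W hk]
    refine ((continuous_spectralKernel (aemeasurable_reducedDensity W hk)
      (lintegral_reducedDensity_ne_top W hk)).tendsto _).comp ?_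
    exact ((ContinuousLinearMap.apply ℝ W (W.orthogonalProjectionOnto v)).continuous.tendsto
      T).comp hU11
  · have hv : 0 < ‖Wᗮ.orthogonalProjectionOnto v‖ := by
      rw [norm_pos_iff, map_sub, sub_ne_zero]
      exact fun h' => h h'.symm
    refine (tendsto_spectralKernel_cocompact _).comp ?_
    rw [← Metric.cobounded_eq_cocompact, ← comap_norm_atTop, tendsto_comap_iff]
    exact tendsto_atTop_mono
      (fun n => (hU22 n _).trans (norm_block_orthogonal_le W (hU21 n) v))
      (hΛ.atTop_mul_const hv)

variable [MeasurableSpace Ω] {P : Measure Ω}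

lemma measurable_perpPart (W : Submodule ℝ V) (hX : Measurable X) : Measurable (perpPart W X) :=
  Wᗮ.orthogonalProjectionOnto.continuous.measurable.comp hX

lemma measurableSet_perpPart_eq (W : Submodule ℝ V) (hX : Measurable X) (a : Wᗮ) :
    MeasurableSet {x | perpPart W X x = a} :=
  measurable_perpPart W hX (measurableSet_singleton a)

lemma integralOp_sliceKernel (hX : Measurable X) (α : Ω → ℂ) (x : Ω) :
    integralOp (sliceKernel kV W X T) P α x =
      integralOp (pullbackKernel (reducedDensity kV W)
        (fun ω => T (W.orthogonalProjectionOnto (X ω))))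
        (P.restrict {x' | perpPart W X x' = perpPart W X x}) α x := by
  rw [integralOp, integralOp, ← integral_indicator (measurableSet_perpPart_eq W hX _)]
  refine integral_congr_ae (Eventually.of_forall fun x' => ?_)
  by_cases h : perpPart W X x' = perpPart W X x <;> simp [sliceKernel, h]

lemma countable_atoms (P : Measure Ω) [SFinite P] (W : Submodule ℝ V) (hX : Measurable X) :
    (atoms P W X).Countable := by
  have h := Measure.countable_meas_level_set_pos (μ := P) (measurable_perpPart W hX)
  refine h.mono fun a ha => ?_
  rw [atoms, Set.mem_ofPred_eq, Measure.map_apply (measurable_perpPart W hX)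
    (measurableSet_singleton a)] at ha
  exact pos_iff_ne_zero.2 ha

end SliceKernel

end KernelRidge

/-! ### The limit of the ridge values -/

open KernelRidge ComplexConjugate in
theorem theorem3
    {V : Type*} [NormedAddCommGroup V] [InnerProductSpace ℝ V] [FiniteDimensional ℝ V]
    [MeasurableSpace V] [BorelSpace V]
    {Ω : Type*} [MeasurableSpace Ω] (P : Measure Ω) [IsProbabilityMeasure P]
    (kV : V → ℝ) (hkV_pos : ∀ ω, 0 < kV ω) (hkV_int : Integrable kV) (hkV_one : ∫ ω, kV ω = 1)
    (X : Ω → V) (hX : Measurable X) (Y : Ω → ℂ) (hY : MemLp Y 2 P)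
    (lam : ℝ) (hlam : 0 < lam)
    (W : Submodule ℝ V)
    (U : ℕ → V →L[ℝ] V) (U11lim : W →L[ℝ] W) (Λ : ℕ → ℝ)
    (hU11 : Tendsto (fun n => KernelRidge.block W W (U n)) atTop (𝓝 U11lim))
    (hU21 : ∀ n, KernelRidge.block W Wᗮ (U n) = 0)
    (hU22 : ∀ n, ∀ x : Wᗮ, Λ n * ‖x‖ ≤ ‖KernelRidge.block Wᗮ Wᗮ (U n) x‖)
    (hΛ : Tendsto Λ atTop atTop) :
    Summable (fun a : KernelRidge.atoms P W X =>
      KernelRidge.reducedJ kV P W X Y a U11lim lam) ∧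
    Tendsto (fun n => KernelRidge.J kV P X Y (U n) lam) atTop
      (𝓝 (1 / 2 * ∫ ω in {ω | KernelRidge.perpPart W X ω ∉ KernelRidge.atoms P W X}, ‖Y ω‖ ^ 2 ∂P
        + ∑' a : KernelRidge.atoms P W X, KernelRidge.reducedJ kV P W X Y a U11lim lam)) := by
  obtain ⟨α, hα, hsol, hlimJ⟩ := exists_tendsto_value (aemeasurable_density hkV_int)
    (lintegral_density_ne_top hkV_int)
    (Eventually.of_forall fun ω => (ENNReal.ofReal_pos.2 (hkV_pos ω)).ne')
    (fun n => (U n).continuous.measurable.comp hX)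
    (tendsto_pullbackKernel_sliceKernel (X := X) hkV_int hU11 hU21 hU22 hΛ) hlam hY
  have hmA (a : Wᗮ) := measurableSet_perpPart_eq W hX a
  have hint : Integrable (fun x => conj (α x) * Y x) P := (memLp_conj hα).integrable_mul hY
  have hcount := countable_atoms P W hX
  have : Countable (atoms P W X) := hcount.to_subtype
  -- On each slice over an atom, `α` solves the equation of the reduced problem.
  have hred (a : atoms P W X) : reducedJ kV P W X Y a U11lim lam =
      1 / 2 * (∫ x in {x | perpPart W X x = a}, conj (α x) * Y x ∂P).re := by
    refine value_eq (aemeasurable_reducedDensity W hkV_int)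
      (lintegral_reducedDensity_ne_top W hkV_int)
      (ae_reducedDensity_ne_zero W hkV_int hkV_pos)
      (U11lim.continuous.measurable.comp
        (W.orthogonalProjectionOnto.continuous.measurable.comp hX)) hlam
      (hα.restrict _) (hY.restrict _) ?_
    filter_upwards [ae_restrict_of_ae hsol, ae_restrict_mem (hmA a)] with x hx hxa
    rw [integralOp_sliceKernel hX, show perpPart W X x = a from hxa] at hx
    exact hx
  -- Off the atoms the slices are null sets, so `α = Y` there.
  have hmN : MeasurableSet {x | perpPart W X x ∉ atoms P W X} :=
    measurable_perpPart W hX hcount.measurableSet.compl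
  have hN : ∫ x in {x | perpPart W X x ∉ atoms P W X}, conj (α x) * Y x ∂P =
      ((∫ x in {x | perpPart W X x ∉ atoms P W X}, ‖Y x‖ ^ 2 ∂P : ℝ) : ℂ) := by
    rw [← integral_conj_mul_self]
    refine integral_congr_ae ?_
    filter_upwards [ae_restrict_of_ae hsol, ae_restrict_mem hmN] with x hx hxN
    have h0 : P {x' | perpPart W X x' = perpPart W X x} = 0 := by
      have h1 := not_not.1 hxN
      rwa [Measure.map_apply (measurable_perpPart W hX) (measurableSet_singleton _)] at h1
    rw [integralOp_sliceKernel hX, Measure.restrict_eq_zero.2 h0, integralOp,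
      integral_zero_measure, add_zero] at hx
    rw [mul_left_cancel₀ (by exact_mod_cast hlam.ne') hx]
  have hunion : {x | perpPart W X x ∉ atoms P W X}ᶜ =
      ⋃ a : atoms P W X, {x | perpPart W X x = a} := by
    ext x
    simp
  have hsum : HasSum (fun a : atoms P W X => reducedJ kV P W X Y a U11lim lam)
      (1 / 2 * (∫ x in {x | perpPart W X x ∉ atoms P W X}ᶜ, conj (α x) * Y x ∂P).re) := by
    simp_rw [hred, hunion]
    refine (Complex.hasSum_re (hasSum_integral_iUnion (fun a : atoms P W X => hmA a) ?_
      hint.integrableOn)).mul_left (1 / 2)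
    intro a b hab
    refine Set.disjoint_left.2 fun x hxa hxb => hab (Subtype.ext ?_)
    exact hxa.symm.trans hxb
  refine ⟨hsum.summable, ?_⟩
  rw [hsum.tsum_eq]
  refine hlimJ.trans_eq ?_
  rw [← integral_add_compl hmN hint, hN, Complex.add_re, Complex.ofReal_re, mul_add]
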